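/- Let $n\ge 0$ be an integer, $\tau\in\mathbb{C}\setminus\{0\}$ and $\gamma\in[0,1)$. Put $w_{\tau,\gamma}(z)=\frac{\tau z}{1+\gamma z}$, let $\Omega_{\tau,\gamma}=w_{\tau,\gamma}(\{z\in\mathbb{C}:|z|<1\})$, and let $$I_\gamma=\{z\in\mathbb{C}:|z|+\gamma|1+z|<1\},\qquad O_\gamma=\{z\in\mathbb{C}:|z|-\gamma|1+z|>1\}$$ (for $\gamma\in(0,1)$ these are the interior of the inner loop and the open exterior of a limaçon of Pascal). Bars denote topological closures in $\mathbb{C}$. For $\Omega\subsetneq\mathbb{C}$ let $\pi_n(\Omega)$ and $\pi_{\le n}(\Omega)$ be the sets of nonzero complex polynomials of degree exactly $n$ and of degree at most $n$, respectively, all of whose zeros lie in $\Omega$. For polynomials $P(z)=\sum_{k=0}^n\binom nk a_kz^k$ and $Q(z)=\sum_{k=0}^n\binom nk b_kz^k$ of degree at most $n$, their Grace–Szegő convolution is $P*_{GS}Q(z)=\sum_{k=0}^n\binom nk a_kb_kz^k$. Let $Q$ be a complex polynomial of degree at most $n$. Then: 1. $P*_{GS}Q\in\pi_n(\Omega_{\tau,\gamma})$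 for all $P\in\pi_n(\overline{\Omega}_{\tau,\gamma})$ if and only if $Q\in\pi_n(I_\gamma)$; 2. $P*_{GS}Q\in\pi_n(\Omega_{\tau,\gamma})$ for all $P\in\pi_n(\Omega_{\tau,\gamma})$ if and only if $Q\in\pi_n(\overline{I}_\gamma)$; 3. $P*_{GS}Q\in\pi_{\le n}(\mathbb{C}\setminus\overline{\Omega}_{\tau,\gamma})$ for all $P\in\pi_{\le n}(\mathbb{C}\setminus\Omega_{\tau,\gamma})$ if and only if $Q\in\pi_{\le n}(O_\gamma)$; 4. $P*_{GS}Q\in\pi_{\le n}(\mathbb{C}\setminus\overline{\Omega}_{\tau,\gamma})$ for all $P\in\pi_{\le n}(\mathbb{C}\setminus\overline{\Omega}_{\tau,\gamma})$ if and only if $Q\in\pi_{\le n}(\overline{O}_\gamma)$; 5. $P*_{GS}Q\in\pi_n(I_\gamma)$ for all $P\in\pi_n(\overline{I}_\gamma)$ if and only if $Q\in\pi_n(I_\gamma)$; 6. $P*_{GS}Q\in\pi_{\le n}(O_\gamma)$ for all $P\in\pi_{\le n}(\overline{O}_\gamma)$ if and only if $Q\in\pi_{\le n}(O_\gamma)$.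 -/

import Mathlib

open Polynomial

/-- `π_n(Ω)`: the complex polynomials of degree exactly `n` (in particular nonzero) all of whose
zeros lie in `Ω`. -/
def polysDegEq (n : ℕ) (Ω : Set ℂ) : Set ℂ[X] :=
  {P | P.degree = (n : WithBot ℕ) ∧ ∀ z : ℂ, P.eval z = 0 → z ∈ Ω}

/-- `π_{≤ n}(Ω)`: the complex polynomials of degree at most `n` all of whose zeros lie in `Ω`.
Every complex number is a zero of the zero polynomial, so the latter is excluded
whenever `Ω ≠ ℂ`. -/
def polysDegLE (n : ℕ) (Ω : Set ℂ) : Set ℂ[X] :=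
  {P | P.degree ≤ (n : WithBot ℕ) ∧ ∀ z : ℂ, P.eval z = 0 → z ∈ Ω}

/-- The Grace–Szegő convolution of two polynomials of degree at most `n`. If
`F = ∑ (n choose k) a_k z^k` and `G = ∑ (n choose k) b_k z^k`, it is
`∑ (n choose k) a_k b_k z^k`; here `a_k = F.coeff k / (n choose k)`, and likewise for `b_k`
(the binomial coefficients do not vanish for `k ≤ n`). -/
noncomputable def gsConv (n : ℕ) (F G : ℂ[X]) : ℂ[X] :=
  ∑ k ∈ Finset.range (n + 1),
    C ((n.choose k : ℂ) * (F.coeff k / (n.choose k : ℂ)) * (G.coeff k / (n.choose k : ℂ))) * X ^ k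

/-- The Möbius transformation `w_{τ,γ}(z) = τ z / (1 + γ z)`; for `0 ≤ γ < 1` the denominator does
not vanish on the closed unit disk. -/
noncomputable def moebiusW (τ : ℂ) (γ : ℝ) (z : ℂ) : ℂ :=
  τ * z / (1 + (γ : ℂ) * z)

/-- `Ω_{τ,γ}`: the image of the open unit disk under `w_{τ,γ}`. -/
def circDomain (τ : ℂ) (γ : ℝ) : Set ℂ :=
  moebiusW τ γ '' Metric.ball (0 : ℂ) 1

/-- `I_γ`: the interior of the inner loop of the limaçon of Pascal. -/
def limaconInner (γ : ℝ) : Set ℂ :=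
  {z | ‖z‖ + γ * ‖1 + z‖ < 1}

/-- `O_γ`: the open exterior of the limaçon of Pascal. -/
def limaconOuter (γ : ℝ) : Set ℂ :=
  {z | 1 < ‖z‖ - γ * ‖1 + z‖}

/-!
The proof rests on two facts: a form of Grace's theorem and a computation with the triangle
inequality.

*Grace's theorem* (`grace`): if a linear functional `L` kills a polynomial of degree `n` all of
whose zeros lie in a disk, then it kills `(X - α) ^ n` for some `α` in the disk. The factors of the
polynomial are split off one at a time: replacing `L` by `F ↦ L ((X - a) F)` replaces
`α ↦ L ((X - α) ^ n)` by a multiple of its polar derivative with respect to `a`, and by Laguerre's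
theorem (`laguerre_polar_derivative`) the latter has no zeros in the disk if the former has none.
Laguerre's theorem in turn says that an average of points of a convex set, the image of the
exterior of the disk under `z ↦ 1 / (α - z)`, stays in that set.

For fixed `Q` and `ζ`, the map `P ↦ (P * Q)(ζ)` is such a functional, and on `(X - α) ^ n` it takes
the value `(-α) ^ n Q (-ζ / α)`. Hence every zero of `P * Q` has the form `-α β` with `β` a zero of
`Q` and `α` in a disk containing the zeros of `P`, or is `0`
(`eval_gsConv_eq_zero_of_disk`). For the exterior of a disk containing `0`, the
polynomial `P` is reversed, which moves its zeros into a disk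
(`eval_gsConv_eq_zero_of_inv_disk`).

Conversely the powers `(X - α) ^ n` and `(1 - a X) ^ n` are test polynomials. So in all four cases
about `Ω_{τ,γ}` the question is for which `β` multiplication by `-β` maps `Ω_{τ,γ}`, its exterior
or one of their closures into the region in question. Since
`Ω_{τ,γ} = {z | ‖z‖ < ‖τ - γ z‖}`, the triangle inequality answers this in terms of
`‖β‖ ± γ ‖1 + β‖` (`neg_mul_mem_circDomain`, `notMem_closure_circDomain_of_lt`), and choosing
arguments that give equality shows that the answer is sharp
(`exists_neg_mul_notMem_circDomain`, `exists_div_mem_closure_circDomain`).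

The two statements about the limaçon itself follow formally: the convolution is associative and
commutative, so the operators of convolution with `P` and with `Q` compose to the one of `P * Q`,
and `(1 + X) ^ n`, whose only possible zero `-1` lies on the limaçon, is a unit for the convolution.
-/

/-! ### Laguerre's theorem on polar derivatives -/

/-- For `α = c + A` in the closed disk of center `c` and radius `r`, this is the image of the
exterior of the disk, the point at infinity included, under `z ↦ 1 / (α - z)`. It is a disk, a
half-plane or, for `r = 0`, the whole plane, hence convex. -/
lemma convex_exterior_inversion {A : ℂ} {r : ℝ} (hr : 0 ≤ r) (hA : ‖A‖ ≤ r) :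
    Convex ℝ {t : ℂ | r * ‖t‖ < ‖A * t - 1‖} := by
  have key : ∀ t : ℂ, r * ‖t‖ < ‖A * t - 1‖ ↔
      0 < 1 - 2 * (A.re * t.re - A.im * t.im)
        - (r ^ 2 - (A.re ^ 2 + A.im ^ 2)) * (t.re ^ 2 + t.im ^ 2) := by
    intro t
    rw [← sq_lt_sq₀ (by positivity) (by positivity), mul_pow, Complex.sq_norm, Complex.sq_norm,
      Complex.normSq_apply, Complex.normSq_apply, ← sub_pos]
    simp only [Complex.sub_re, Complex.sub_im, Complex.mul_re, Complex.mul_im, Complex.one_re,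
      Complex.one_im]
    ring_nf
  have hA' : 0 ≤ r ^ 2 - (A.re ^ 2 + A.im ^ 2) := by
    have h := pow_le_pow_left₀ (norm_nonneg A) hA 2
    rw [Complex.sq_norm, Complex.normSq_apply] at h
    linarith
  intro t ht u hu a b ha hb hab
  simp only [Set.mem_ofPred_eq, key] at ht hu ⊢
  simp only [Complex.add_re, Complex.add_im, Complex.real_smul, Complex.mul_re, Complex.mul_im,
    Complex.ofReal_re, Complex.ofReal_im, zero_mul, sub_zero, add_zero]
  obtain rfl : b = 1 - a := by linarith
  -- The defect of concavity of a quadratic form is `a * b` times its value at `t - u`.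
  have hdef := mul_nonneg (mul_nonneg ha hb) (mul_nonneg hA'
    (add_nonneg (sq_nonneg (t.re - u.re)) (sq_nonneg (t.im - u.im))))
  rcases ha.eq_or_lt with rfl | ha'
  · linarith
  · have h1 := mul_pos ha' ht
    have h2 := mul_nonneg hb hu.le
    linarith

lemma multiset_sum_mem_nsmul_of_convex {S : Set ℂ} (hS : Convex ℝ S) (h0 : (0 : ℂ) ∈ S)
    (s : Multiset ℂ) (hs : ∀ t ∈ s, t ∈ S) :
    ∀ n : ℕ, Multiset.card s ≤ n → ∃ u ∈ S, s.sum = n * u := by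
  induction s using Multiset.induction_on with
  | empty => exact fun n _ => ⟨0, h0, by simp⟩
  | cons t s ih =>
    intro n hn
    rw [Multiset.card_cons] at hn
    obtain ⟨m, rfl⟩ : ∃ m, n = m + 1 := ⟨n - 1, by omega⟩
    obtain ⟨u, hu, hsum⟩ := ih (fun x hx => hs x (Multiset.mem_cons_of_mem hx)) m (by omega)
    have hm : (0 : ℝ) < m + 1 := by positivity
    refine ⟨(1 / (m + 1 : ℝ)) • t + (m / (m + 1 : ℝ)) • u,
      hS (hs t (Multiset.mem_cons_self t s)) hu (by positivity) (by positivity)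
        (by field_simp; ring), ?_⟩
    have hm' : (m + 1 : ℂ) ≠ 0 := by exact_mod_cast hm.ne'
    rw [Multiset.sum_cons, hsum]
    simp only [Complex.real_smul]
    push_cast
    field_simp

/-- Laguerre's theorem: if a polynomial of degree at most `n` has no zero in a closed disk, then
neither has its polar derivative `n G + (α' - z) G'` with respect to a point `α'` of the disk. -/
theorem laguerre_polar_derivative {n : ℕ} (hn : 0 < n) {G : ℂ[X]} (hG : G.natDegree ≤ n)
    {c : ℂ} {r : ℝ} (h0 : ∀ z ∈ Metric.closedBall c r, G.eval z ≠ 0)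
    {α α' : ℂ} (hα : α ∈ Metric.closedBall c r) (hα' : α' ∈ Metric.closedBall c r) :
    n * G.eval α + (α' - α) * G.derivative.eval α ≠ 0 := by
  intro h
  have hGα := h0 α hα
  have hnC : (n : ℂ) ≠ 0 := by exact_mod_cast hn.ne'
  rw [Metric.mem_closedBall, dist_eq_norm] at hα hα'
  have hr : 0 ≤ r := (norm_nonneg _).trans hα
  have hconv := convex_exterior_inversion hr hα
  obtain ⟨u, hu, hsum⟩ := multiset_sum_mem_nsmul_of_convex hconv (by simp)
    (G.roots.map fun z => 1 / (α - z)) (by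
      intro t ht
      obtain ⟨z, hz, rfl⟩ := Multiset.mem_map.1 ht
      have hz0 : G.eval z = 0 := (mem_roots'.1 hz).2
      have hzr : r < ‖z - c‖ := by
        by_contra hle
        exact h0 z (by rw [Metric.mem_closedBall, dist_eq_norm]; linarith) hz0
      have hαz : α - z ≠ 0 := fun h' => hGα (by rw [sub_eq_zero.1 h']; exact hz0)
      have : (α - c) * (1 / (α - z)) - 1 = (z - c) * (1 / (α - z)) := by field_simp; ring
      rw [Set.mem_ofPred_eq, this, norm_mul]
      exact mul_lt_mul_of_pos_right hzr (norm_pos_iff.2 (one_div_ne_zero hαz))) n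
    (by rw [Multiset.card_map]; exact (card_roots' G).trans hG)
  rw [← (IsAlgClosed.splits G).eval_derivative_div_eval_of_ne_zero hGα,
    div_eq_iff hGα] at hsum
  rw [hsum] at h
  have h1 : (α' - α) * u = -1 := by
    have : (n * G.eval α) * (1 + (α' - α) * u) = 0 := by linear_combination h
    rcases mul_eq_zero.1 this with h' | h'
    · exact absurd h' (mul_ne_zero hnC hGα)
    · linear_combination h'
  have h2 : (α - c) * u - 1 = (α' - c) * u := by linear_combination -h1
  rw [Set.mem_ofPred_eq, h2, norm_mul] at hu
  exact absurd (mul_le_mul_of_nonneg_right hα' (norm_nonneg u)) (not_le.2 hu)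

/-! ### Grace's theorem -/

/-- The polynomial `α ↦ L ((X - α) ^ n)` attached to a linear functional `L` on polynomials. -/
noncomputable def powerTransform (L : ℂ[X] →ₗ[ℂ] ℂ) (n : ℕ) : ℂ[X] :=
  ∑ k ∈ Finset.range (n + 1), C ((n.choose k : ℂ) * L (X ^ k)) * (-X) ^ (n - k)

lemma eval_powerTransform (L : ℂ[X] →ₗ[ℂ] ℂ) (n : ℕ) (α : ℂ) :
    (powerTransform L n).eval α = L ((X - C α) ^ n) := by
  rw [sub_eq_add_neg, add_pow, map_sum, powerTransform, eval_finsetSum]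
  refine Finset.sum_congr rfl fun k _ => ?_
  have : (X ^ k * (-C α) ^ (n - k) * (n.choose k : ℂ[X]) : ℂ[X])
      = ((n.choose k : ℂ) * (-α) ^ (n - k)) • X ^ k := by
    rw [smul_eq_C_mul]
    simp only [C_mul, C_pow, C_neg, C_eq_natCast]
    ring
  rw [this, map_smul, smul_eq_mul]
  simp only [eval_mul, eval_C, eval_pow, eval_neg, eval_X]
  ring

lemma natDegree_powerTransform_le (L : ℂ[X] →ₗ[ℂ] ℂ) (n : ℕ) :
    (powerTransform L n).natDegree ≤ n := by
  refine natDegree_sum_le_of_forall_le _ _ fun k _ => ?_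
  refine (natDegree_C_mul_le _ _).trans ((natDegree_pow_le).trans ?_)
  rw [natDegree_neg, natDegree_X]
  omega

lemma derivative_powerTransform_succ (L : ℂ[X] →ₗ[ℂ] ℂ) (n : ℕ) :
    derivative (powerTransform L (n + 1)) = -(C (n + 1 : ℂ) * powerTransform L n) := by
  rw [powerTransform, Finset.sum_range_succ, powerTransform, derivative_add, derivative_sum,
    Finset.mul_sum, ← Finset.sum_neg_distrib]
  simp only [tsub_self, pow_zero, mul_one, derivative_C, add_zero]
  refine Finset.sum_congr rfl fun k hk => ?_
  have hk' : k ≤ n := Nat.lt_succ_iff.1 (Finset.mem_range.1 hk)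
  have h1 : n + 1 - k = (n - k) + 1 := by omega
  have hc : ((n.choose k : ℂ)) * (n + 1) = ((n + 1).choose k : ℂ) * ((n - k : ℕ) + 1) := by
    have := Nat.choose_mul_succ_eq n k
    rw [h1] at this
    exact_mod_cast this
  have hcC := congrArg (C : ℂ → ℂ[X]) hc
  simp only [C_mul, C_add, C_eq_natCast, C_1] at hcC
  rw [h1, derivative_C_mul, derivative_pow_succ]
  simp only [derivative_neg, derivative_X, C_mul, C_add, C_eq_natCast, C_1]
  linear_combination (C (L (X ^ k)) * (-X) ^ (n - k)) * hcC

/-- Grace's theorem for a linear functional and a product of linear factors: fixing one factor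
`X - a` turns `α ↦ L ((X - α) ^ (n + 1))` into its polar derivative with respect to `a`, so
Laguerre's theorem allows an induction on the number of factors. -/
theorem grace_multiset_prod {c : ℂ} {r : ℝ} (hr : 0 ≤ r) (s : Multiset ℂ)
    (hs : ∀ a ∈ s, a ∈ Metric.closedBall c r) (L : ℂ[X] →ₗ[ℂ] ℂ)
    (hL : ∀ α ∈ Metric.closedBall c r, L ((X - C α) ^ Multiset.card s) ≠ 0) :
    L (s.map fun a => X - C a).prod ≠ 0 := by
  induction s using Multiset.induction_on generalizing L with
  | empty => simpa using hL c (Metric.mem_closedBall_self hr)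
  | cons a s ih =>
    rw [Multiset.map_cons, Multiset.prod_cons]
    refine ih (fun x hx => hs x (Multiset.mem_cons_of_mem hx))
      (L ∘ₗ LinearMap.mulLeft ℂ (X - C a)) fun α hα h => ?_
    rw [Multiset.card_cons] at hL
    set m := Multiset.card s
    refine laguerre_polar_derivative (Nat.succ_pos m) (natDegree_powerTransform_le L (m + 1))
      (fun z hz => by rw [eval_powerTransform]; exact hL z hz) hα
      (hs a (Multiset.mem_cons_self a s)) ?_
    have h' : L ((X - C a) * (X - C α) ^ m) = 0 := h
    have h2 : (X - C a) * (X - C α) ^ m = (X - C α) ^ (m + 1) + (α - a) • (X - C α) ^ m := by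
      rw [smul_eq_C_mul, C_sub]; ring
    rw [h2, map_add, map_smul, smul_eq_mul] at h'
    rw [derivative_powerTransform_succ]
    simp only [eval_neg, eval_mul, eval_C, eval_powerTransform]
    push_cast
    linear_combination (m + 1 : ℂ) * h'

/-- A nonempty disk of the complex plane, open or closed (a single point counts as closed). -/
def IsDisk (K : Set ℂ) : Prop :=
  (∃ c r, 0 ≤ r ∧ K = Metric.closedBall c r) ∨ ∃ c r, 0 < r ∧ K = Metric.ball c r

/-- Grace's theorem: if a linear functional annihilates a polynomial of degree `n` with all its
zeros in a disk, it annihilates some `(X - α) ^ n` with `α` in the disk. -/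
theorem grace {K : Set ℂ} (hK : IsDisk K) {n : ℕ} {F : ℂ[X]} (hF : F ∈ polysDegEq n K)
    (L : ℂ[X] →ₗ[ℂ] ℂ) (hL : L F = 0) : ∃ α ∈ K, L ((X - C α) ^ n) = 0 := by
  obtain ⟨hdeg, hroots⟩ := hF
  have hF0 : F ≠ 0 := by rintro rfl; simp at hdeg
  have hcard : Multiset.card F.roots = n := by
    rw [← natDegree_eq_of_degree_eq_some hdeg]
    exact (IsAlgClosed.splits F).natDegree_eq_card_roots.symm
  have closed : ∀ c r, 0 ≤ r → (∀ z ∈ F.roots, z ∈ Metric.closedBall c r) →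
      ∃ α ∈ Metric.closedBall c r, L ((X - C α) ^ n) = 0 := by
    intro c r hr hz
    by_contra! hne
    refine grace_multiset_prod hr F.roots hz L (by rwa [hcard]) ?_
    have hprod := (IsAlgClosed.splits F).eq_prod_roots
    rw [hprod, ← smul_eq_C_mul, map_smul, smul_eq_mul] at hL
    exact (mul_eq_zero.1 hL).resolve_left (leadingCoeff_ne_zero.2 hF0)
  have hz : ∀ z ∈ F.roots, z ∈ K := fun z hz => hroots z (mem_roots'.1 hz).2
  rcases hK with ⟨c, r, hr, rfl⟩ | ⟨c, r, hr, rfl⟩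
  · exact closed c r hr hz
  · -- The finitely many zeros already lie in a smaller closed disk.
    obtain ⟨r', hr', hsub⟩ := exists_pos_lt_subset_ball hr
      (F.roots.toFinset.finite_toSet.isClosed) (fun z hz' => hz z (by simpa using hz'))
    obtain ⟨α, hα, h⟩ := closed c r' hr'.1.le fun z hz' =>
      Metric.ball_subset_closedBall (hsub (by simpa using hz'))
    exact ⟨α, Metric.closedBall_subset_ball hr'.2 hα, h⟩

/-! ### The Grace–Szegő convolution -/

lemma choose_cast_ne_zero {n k : ℕ} (hk : k ≤ n) : (n.choose k : ℂ) ≠ 0 := by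
  exact_mod_cast (Nat.choose_pos hk).ne'

lemma coeff_gsConv (n : ℕ) (F G : ℂ[X]) (k : ℕ) :
    (gsConv n F G).coeff k = if k ≤ n then F.coeff k * G.coeff k / n.choose k else 0 := by
  simp only [gsConv, finsetSum_coeff, coeff_C_mul_X_pow, Finset.sum_ite_eq, Finset.mem_range,
    Nat.lt_succ_iff]
  split_ifs with hk
  · have := choose_cast_ne_zero hk
    field_simp
  · rfl

lemma gsConv_comm (n : ℕ) (F G : ℂ[X]) : gsConv n F G = gsConv n G F := by
  ext k; simp only [coeff_gsConv, mul_comm]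

lemma gsConv_assoc (n : ℕ) (F G H : ℂ[X]) :
    gsConv n (gsConv n F G) H = gsConv n F (gsConv n G H) := by
  ext k
  simp only [coeff_gsConv]
  split_ifs <;> ring

lemma degree_gsConv_le (n : ℕ) (F G : ℂ[X]) : (gsConv n F G).degree ≤ n := by
  rw [degree_le_iff_coeff_zero]
  intro m hm
  rw [coeff_gsConv, if_neg (not_le.2 (by exact_mod_cast hm))]

lemma degree_eq_iff_coeff_ne_zero {n : ℕ} {F : ℂ[X]} (hF : F.degree ≤ n) :
    F.degree = n ↔ F.coeff n ≠ 0 :=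
  ⟨coeff_ne_zero_of_eq_degree, fun h => hF.antisymm (le_degree_of_ne_zero h)⟩

lemma coeff_gsConv_self (n : ℕ) (F G : ℂ[X]) :
    (gsConv n F G).coeff n = F.coeff n * G.coeff n := by
  simp [coeff_gsConv]

lemma eval_gsConv (n : ℕ) (F G : ℂ[X]) (ζ : ℂ) :
    (gsConv n F G).eval ζ =
      ∑ k ∈ Finset.range (n + 1), F.coeff k * (G.coeff k / n.choose k * ζ ^ k) := by
  rw [gsConv, eval_finsetSum]
  refine Finset.sum_congr rfl fun k hk => ?_
  have := choose_cast_ne_zero (Nat.lt_succ_iff.1 (Finset.mem_range.1 hk))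
  simp only [eval_mul, eval_C, eval_pow, eval_X]
  field_simp

lemma eval_eq_sum_range_of_degree_le {n : ℕ} {Q : ℂ[X]} (hQ : Q.degree ≤ n) (z : ℂ) :
    Q.eval z = ∑ k ∈ Finset.range (n + 1), Q.coeff k * z ^ k :=
  eval_eq_sum_range' (Nat.lt_succ_iff.2 (natDegree_le_of_degree_le hQ)) z

lemma coeff_one_sub_C_mul_X_pow (n : ℕ) (a : ℂ) (k : ℕ) :
    ((1 - C a * X : ℂ[X]) ^ n).coeff k = n.choose k * (-a) ^ k := by
  have h1 : (1 - C a * X : ℂ[X]) ^ n = ((1 + X) ^ n).comp (C (-a) * X) := by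
    simp [sub_eq_add_neg]
  rw [h1, comp_C_mul_X_coeff, coeff_one_add_X_pow]

/-- Convolution with `(1 - a z) ^ n` is the substitution `z ↦ -a z`. -/
lemma eval_gsConv_one_sub_C_mul_X_pow {n : ℕ} {Q : ℂ[X]} (hQ : Q.degree ≤ n) (a ζ : ℂ) :
    (gsConv n ((1 - C a * X) ^ n) Q).eval ζ = Q.eval (-a * ζ) := by
  rw [eval_gsConv, eval_eq_sum_range_of_degree_le hQ]
  refine Finset.sum_congr rfl fun k hk => ?_
  have hk' := Nat.lt_succ_iff.1 (Finset.mem_range.1 hk)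
  have := choose_cast_ne_zero hk'
  rw [coeff_one_sub_C_mul_X_pow, mul_pow]
  field_simp

/-- Convolution with `(z - α) ^ n`, in a form that stays meaningful at `α = 0`. -/
lemma eval_gsConv_X_sub_C_pow (n : ℕ) (Q : ℂ[X]) (α ζ : ℂ) :
    (gsConv n ((X - C α) ^ n) Q).eval ζ =
      ∑ k ∈ Finset.range (n + 1), (-α) ^ (n - k) * Q.coeff k * ζ ^ k := by
  rw [eval_gsConv]
  refine Finset.sum_congr rfl fun k hk => ?_
  have := choose_cast_ne_zero (Nat.lt_succ_iff.1 (Finset.mem_range.1 hk))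
  rw [sub_eq_add_neg, ← C_neg, coeff_X_add_C_pow]
  field_simp

lemma eval_gsConv_X_sub_C_pow_neg_mul {n : ℕ} {Q : ℂ[X]} (hQ : Q.degree ≤ n) (α β : ℂ) :
    (gsConv n ((X - C α) ^ n) Q).eval (-α * β) = (-α) ^ n * Q.eval β := by
  rw [eval_gsConv_X_sub_C_pow, eval_eq_sum_range_of_degree_le hQ, Finset.mul_sum]
  refine Finset.sum_congr rfl fun k hk => ?_
  have hk' := Nat.lt_succ_iff.1 (Finset.mem_range.1 hk)
  rw [mul_pow, ← pow_sub_mul_pow (-α) hk']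
  ring

/-- Szegő's theorem for a disk: a zero of the convolution is the negative of the product of
a point of a disk containing the zeros of `P` and a zero of `Q`. -/
theorem eval_gsConv_eq_zero_of_disk {K : Set ℂ} (hK : IsDisk K) {n : ℕ} {P Q : ℂ[X]}
    (hP : P ∈ polysDegEq n K) (hQ : Q.degree = n) {ζ : ℂ} (hζ : (gsConv n P Q).eval ζ = 0) :
    ζ = 0 ∨ ∃ α ∈ K, ∃ β, Q.eval β = 0 ∧ ζ = -α * β := by
  let L : ℂ[X] →ₗ[ℂ] ℂ :=
    ∑ k ∈ Finset.range (n + 1), (Q.coeff k / n.choose k * ζ ^ k) • lcoeff ℂ k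
  have hL : ∀ F, L F = (gsConv n F Q).eval ζ := by
    intro F
    simp only [L, eval_gsConv, LinearMap.sum_apply, LinearMap.smul_apply, lcoeff_apply,
      smul_eq_mul, mul_comm]
  obtain ⟨α, hα, h⟩ := grace hK hP L (by rw [hL, hζ])
  rw [hL] at h
  by_cases hα0 : α = 0
  · left
    rw [eval_gsConv_X_sub_C_pow, Finset.sum_range_succ, Finset.sum_eq_zero, hα0] at h
    · simp only [tsub_self, pow_zero, one_mul, zero_add] at h
      exact eq_zero_of_pow_eq_zero
        ((mul_eq_zero.1 h).resolve_left (coeff_ne_zero_of_eq_degree hQ))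
    · intro k hk
      rw [hα0, neg_zero, zero_pow (Nat.sub_ne_zero_of_lt (Finset.mem_range.1 hk))]
      ring
  · right
    have hζ' : ζ = -α * (-ζ / α) := by field_simp
    refine ⟨α, hα, -ζ / α, ?_, hζ'⟩
    rw [hζ', eval_gsConv_X_sub_C_pow_neg_mul hQ.le] at h
    exact (mul_eq_zero.1 h).resolve_left (pow_ne_zero _ (neg_ne_zero.2 hα0))

lemma reflect_X_sub_C_pow (n : ℕ) (a : ℂ) :
    ((X - C a) ^ n).reflect n = (1 - C a * X) ^ n := by
  ext k
  rw [coeff_one_sub_C_mul_X_pow, coeff_reflect, sub_eq_add_neg, ← C_neg,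
    coeff_X_add_C_pow]
  rcases le_or_gt k n with hk | hk
  · rw [revAt_le hk, Nat.sub_sub_self hk, Nat.choose_symm hk, mul_comm]
  · rw [revAt_eq_self_of_lt hk, Nat.choose_eq_zero_of_lt hk]
    simp

/-- The reversal of `P` has degree exactly `n`, and its zeros are the inverses of the zeros of `P`,
where `0` stands for a zero of `P` at infinity. -/
lemma reflect_mem_polysDegEq {U K : Set ℂ} (h0 : (0 : ℂ) ∈ K) (h0U : (0 : ℂ) ∉ U)
    (hUK : ∀ z ∈ U, z⁻¹ ∈ K) {n : ℕ} {P : ℂ[X]} (hP : P ∈ polysDegLE n U) :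
    P.reflect n ∈ polysDegEq n K := by
  have hdeg := natDegree_le_of_degree_le hP.1
  have hc : P.coeff 0 ≠ 0 := fun h => h0U (hP.2 0 (by rwa [← coeff_zero_eq_eval_zero]))
  refine ⟨?_, fun z hz => ?_⟩
  · rw [degree_eq_iff_coeff_ne_zero]
    · rwa [coeff_reflect, revAt_le le_rfl, tsub_self]
    · exact degree_le_of_natDegree_le (natDegree_reflect_le.trans (by simp [hdeg]))
  · rcases eq_or_ne z 0 with rfl | hz0
    · exact h0
    · have : Invertible z⁻¹ := invertibleOfNonzero (inv_ne_zero hz0)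
      have h := eval₂_reflect_mul_pow (RingHom.id ℂ) z⁻¹ n P hdeg
      rw [invOf_eq_inv, inv_inv, ← eval, ← eval, hz, zero_mul] at h
      simpa using hUK _ (hP.2 _ h.symm)

/-- Szegő's theorem for the exterior of a disk. Here `U` is a region with `∞` adjoined and `K` is
its image, a disk, under `z ↦ z⁻¹`; reversing `P` moves its zeros into `K`. -/
theorem eval_gsConv_eq_zero_of_inv_disk {U K : Set ℂ} (hK : IsDisk K) (h0 : (0 : ℂ) ∈ K)
    (h0U : (0 : ℂ) ∉ U) (hUK : ∀ z ∈ U, z⁻¹ ∈ K) {n : ℕ} {P Q : ℂ[X]}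
    (hP : P ∈ polysDegLE n U) (hQ : Q.degree ≤ n) {ζ : ℂ} (hζ : (gsConv n P Q).eval ζ = 0) :
    ∃ a ∈ K, Q.eval (-a * ζ) = 0 := by
  let L : ℂ[X] →ₗ[ℂ] ℂ :=
    ∑ k ∈ Finset.range (n + 1), (Q.coeff k / n.choose k * ζ ^ k) • lcoeff ℂ (revAt n k)
  have hL : ∀ F, L F = (gsConv n (F.reflect n) Q).eval ζ := by
    intro F
    simp only [L, eval_gsConv, LinearMap.sum_apply, LinearMap.smul_apply, lcoeff_apply,
      smul_eq_mul, mul_comm, coeff_reflect]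
  have hinv : (P.reflect n).reflect n = P := by
    ext k; rw [coeff_reflect, coeff_reflect, revAt_invol]
  obtain ⟨a, ha, h⟩ := grace hK (reflect_mem_polysDegEq h0 h0U hUK hP) L (by rw [hL, hinv, hζ])
  rw [hL, reflect_X_sub_C_pow, eval_gsConv_one_sub_C_mul_X_pow hQ] at h
  exact ⟨a, ha, h⟩

/-! ### The disk `Ω_{τ,γ}` -/

section Geometry

variable {τ : ℂ} {γ : ℝ}

lemma mem_circDomain (hτ : τ ≠ 0) (hγ0 : 0 ≤ γ) (hγ1 : γ < 1) {z : ℂ} :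
    z ∈ circDomain τ γ ↔ ‖z‖ < ‖τ - γ * z‖ := by
  constructor
  · rintro ⟨u, hu, rfl⟩
    rw [mem_ball_zero_iff] at hu
    have hden : 1 + (γ : ℂ) * u ≠ 0 := by
      intro h
      have h1 : ‖(γ : ℂ) * u‖ = 1 := by rw [eq_neg_of_add_eq_zero_right h]; simp
      rw [norm_mul, Complex.norm_real, Real.norm_of_nonneg hγ0] at h1
      nlinarith [norm_nonneg u]
    have h1 : moebiusW τ γ u = u * (τ / (1 + γ * u)) := by rw [moebiusW]; ring
    have h2 : τ - γ * moebiusW τ γ u = τ / (1 + γ * u) := by rw [moebiusW]; field_simp; ring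
    rw [h2, h1, norm_mul]
    exact mul_lt_of_lt_one_left (norm_pos_iff.2 (div_ne_zero hτ hden)) hu
  · intro h
    have hD : τ - γ * z ≠ 0 := norm_pos_iff.1 ((norm_nonneg z).trans_lt h)
    refine ⟨z / (τ - γ * z), ?_, ?_⟩
    · rw [mem_ball_zero_iff, norm_div, div_lt_one (norm_pos_iff.2 hD)]
      exact h
    · have : 1 + (γ : ℂ) * (z / (τ - γ * z)) = τ / (τ - γ * z) := by field_simp; ring
      rw [moebiusW, this, ← mul_div_assoc, div_div_div_cancel_right₀ hD, mul_div_cancel_left₀ _ hτ]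

lemma one_sub_sq_pos (hγ0 : 0 ≤ γ) (hγ1 : γ < 1) : 0 < 1 - γ ^ 2 := by nlinarith

/-- Up to positive factors, `‖z - c‖² - R²` equals `‖z‖² - ‖τ - γ z‖²`, where `c` and `R` are the
center and the radius of `Ω_{τ,γ}`. -/
lemma dist_center_sq_sub (hγ0 : 0 ≤ γ) (hγ1 : γ < 1) (z : ℂ) :
    dist z (-(γ * τ / (1 - γ ^ 2))) ^ 2 - (‖τ‖ / (1 - γ ^ 2)) ^ 2 =
      (‖z‖ ^ 2 - ‖τ - γ * z‖ ^ 2) / (1 - γ ^ 2) := by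
  have h := one_sub_sq_pos hγ0 hγ1
  have hC : (1 - (γ : ℂ) ^ 2) ≠ 0 := by exact_mod_cast h.ne'
  have h1 : z - -(γ * τ / (1 - γ ^ 2)) = ((1 - γ ^ 2) * z + γ * τ) / ((1 - γ ^ 2 : ℝ) : ℂ) := by
    push_cast
    field_simp
    ring
  rw [dist_eq_norm, h1, norm_div, Complex.norm_real, Real.norm_of_nonneg h.le]
  have h2 : ‖(1 - (γ : ℂ) ^ 2) * z + γ * τ‖ ^ 2 - ‖τ‖ ^ 2 =
      (1 - γ ^ 2) * (‖z‖ ^ 2 - ‖τ - γ * z‖ ^ 2) := by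
    have h3 : (1 - (γ : ℂ) ^ 2) * z + γ * τ = ((1 - γ ^ 2 : ℝ) : ℂ) * z + γ * τ := by push_cast; rfl
    rw [h3]
    simp only [Complex.sq_norm, Complex.normSq_apply, Complex.add_re, Complex.add_im,
      Complex.sub_re, Complex.sub_im, Complex.re_ofReal_mul, Complex.im_ofReal_mul]
    ring
  field_simp
  linear_combination h2

lemma circDomain_eq_ball (hτ : τ ≠ 0) (hγ0 : 0 ≤ γ) (hγ1 : γ < 1) :
    circDomain τ γ = Metric.ball (-(γ * τ / (1 - γ ^ 2))) (‖τ‖ / (1 - γ ^ 2)) := by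
  have h := one_sub_sq_pos hγ0 hγ1
  ext z
  rw [mem_circDomain hτ hγ0 hγ1, Metric.mem_ball,
    ← sq_lt_sq₀ dist_nonneg (div_nonneg (norm_nonneg τ) h.le),
    ← sq_lt_sq₀ (norm_nonneg z) (norm_nonneg _), ← sub_neg, ← sub_neg (a := dist _ _ ^ 2),
    dist_center_sq_sub hγ0 hγ1, div_neg_iff]
  constructor
  · exact fun h' => Or.inr ⟨h', h⟩
  · rintro (h' | h')
    · linarith [h'.2]
    · exact h'.1

lemma closure_circDomain_eq_closedBall (hτ : τ ≠ 0) (hγ0 : 0 ≤ γ) (hγ1 : γ < 1) :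
    closure (circDomain τ γ) =
      Metric.closedBall (-(γ * τ / (1 - γ ^ 2))) (‖τ‖ / (1 - γ ^ 2)) := by
  rw [circDomain_eq_ball hτ hγ0 hγ1, closure_ball]
  exact (div_pos (norm_pos_iff.2 hτ) (one_sub_sq_pos hγ0 hγ1)).ne'

lemma mem_closure_circDomain (hτ : τ ≠ 0) (hγ0 : 0 ≤ γ) (hγ1 : γ < 1) {z : ℂ} :
    z ∈ closure (circDomain τ γ) ↔ ‖z‖ ≤ ‖τ - γ * z‖ := by
  have h := one_sub_sq_pos hγ0 hγ1
  rw [closure_circDomain_eq_closedBall hτ hγ0 hγ1, Metric.mem_closedBall,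
    ← sq_le_sq₀ dist_nonneg (div_nonneg (norm_nonneg τ) h.le),
    ← sq_le_sq₀ (norm_nonneg z) (norm_nonneg _), ← sub_nonpos,
    dist_center_sq_sub hγ0 hγ1, ← sub_nonpos (a := ‖z‖ ^ 2), div_nonpos_iff]
  constructor
  · rintro (h' | h')
    · linarith [h'.2]
    · exact h'.1
  · exact fun h' => Or.inr ⟨h', h.le⟩

lemma isDisk_circDomain (hτ : τ ≠ 0) (hγ0 : 0 ≤ γ) (hγ1 : γ < 1) : IsDisk (circDomain τ γ) :=
  Or.inr ⟨_, _, div_pos (norm_pos_iff.2 hτ) (one_sub_sq_pos hγ0 hγ1),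
    circDomain_eq_ball hτ hγ0 hγ1⟩

lemma isDisk_closure_circDomain (hτ : τ ≠ 0) (hγ0 : 0 ≤ γ) (hγ1 : γ < 1) :
    IsDisk (closure (circDomain τ γ)) :=
  Or.inl ⟨_, _, (div_pos (norm_pos_iff.2 hτ) (one_sub_sq_pos hγ0 hγ1)).le,
    closure_circDomain_eq_closedBall hτ hγ0 hγ1⟩

lemma norm_mul_sub_eq (hτ : τ ≠ 0) (a : ℂ) :
    ‖τ * a - γ‖ = ‖τ‖ * dist a (γ / τ) := by
  rw [dist_eq_norm, ← norm_mul]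
  congr 1
  field_simp

/-- The image of the complement of `Ω_{τ,γ}` under inversion, with `0` for the image of `∞`. -/
lemma isDisk_inv_compl_circDomain (hτ : τ ≠ 0) : IsDisk {a : ℂ | ‖τ * a - γ‖ ≤ 1} := by
  refine Or.inl ⟨γ / τ, 1 / ‖τ‖, by positivity, ?_⟩
  ext a
  rw [Set.mem_ofPred_eq, norm_mul_sub_eq hτ, Metric.mem_closedBall,
    le_div_iff₀' (norm_pos_iff.2 hτ)]

lemma isDisk_inv_compl_closure_circDomain (hτ : τ ≠ 0) : IsDisk {a : ℂ | ‖τ * a - γ‖ < 1} := by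
  refine Or.inr ⟨γ / τ, 1 / ‖τ‖, by positivity, ?_⟩
  ext a
  rw [Set.mem_ofPred_eq, norm_mul_sub_eq hτ, Metric.mem_ball,
    lt_div_iff₀' (norm_pos_iff.2 hτ)]

lemma norm_mul_inv_sub {z : ℂ} (hz : z ≠ 0) : ‖τ * z⁻¹ - γ‖ = ‖τ - γ * z‖ / ‖z‖ := by
  rw [← norm_div]
  congr 1
  field_simp

/-! ### The limaçon -/

lemma mem_closure_of_eventually_add_mul {S : Set ℂ} {z w : ℂ}
    (h : ∀ ε : ℝ, 0 < ε → ε < 1 → z + ε * w ∈ S) : z ∈ closure S := by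
  have ht : Filter.Tendsto (fun ε : ℝ => z + ε * w) (nhdsWithin 0 (Set.Ioi 0)) (nhds z) := by
    have hc : Continuous fun ε : ℝ => z + ε * w := by fun_prop
    have := hc.tendsto 0
    simp only [Complex.ofReal_zero, zero_mul, add_zero] at this
    exact this.mono_left nhdsWithin_le_nhds
  refine mem_closure_of_tendsto ht ?_
  filter_upwards [Ioo_mem_nhdsGT (zero_lt_one' ℝ)] with ε hε using h ε hε.1 hε.2

lemma closure_limaconInner (hγ0 : 0 ≤ γ) (hγ1 : γ < 1) :
    closure (limaconInner γ) = {z | ‖z‖ + γ * ‖1 + z‖ ≤ 1} := by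
  apply Set.Subset.antisymm
  · exact closure_minimal (fun z (hz : ‖z‖ + γ * ‖1 + z‖ < 1) => hz.le)
      (isClosed_le (by fun_prop) continuous_const)
  · intro z (hz : ‖z‖ + γ * ‖1 + z‖ ≤ 1)
    -- The set is star-shaped about `0`, where the defining function has the value `γ < 1`.
    refine mem_closure_of_eventually_add_mul (w := -z) fun ε h0 h1 => ?_
    have e1 : z + ε * -z = ((1 - ε : ℝ) : ℂ) * z := by push_cast; ring
    have e2 : 1 + ((1 - ε : ℝ) : ℂ) * z = ((1 - ε : ℝ) : ℂ) * (1 + z) + (ε : ℂ) := by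
      push_cast; ring
    have n1 : ‖((1 - ε : ℝ) : ℂ) * z‖ = (1 - ε) * ‖z‖ := by
      rw [norm_mul, Complex.norm_real, Real.norm_of_nonneg (by linarith)]
    have n2 : ‖((1 - ε : ℝ) : ℂ) * (1 + z) + (ε : ℂ)‖ ≤ (1 - ε) * ‖1 + z‖ + ε := by
      refine (norm_add_le _ _).trans ?_
      rw [norm_mul, Complex.norm_real, Complex.norm_real, Real.norm_of_nonneg h0.le,
        Real.norm_of_nonneg (by linarith : 0 ≤ 1 - ε)]
    change ‖z + ε * -z‖ + γ * ‖1 + (z + ε * -z)‖ < 1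
    rw [e1, e2, n1]
    have h3 := mul_le_mul_of_nonneg_left n2 hγ0
    have h4 := mul_le_mul_of_nonneg_left hz (by linarith : 0 ≤ 1 - ε)
    have h5 := mul_lt_mul_of_pos_left hγ1 h0
    linarith

lemma closure_limaconOuter (hγ0 : 0 ≤ γ) (hγ1 : γ < 1) :
    closure (limaconOuter γ) = {z | 1 ≤ ‖z‖ - γ * ‖1 + z‖} := by
  apply Set.Subset.antisymm
  · exact closure_minimal (fun z (hz : 1 < ‖z‖ - γ * ‖1 + z‖) => hz.le)
      (isClosed_le continuous_const (by fun_prop))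
  · intro z (hz : 1 ≤ ‖z‖ - γ * ‖1 + z‖)
    -- The defining function grows along the ray from `0` through `z`.
    refine mem_closure_of_eventually_add_mul (w := z) fun ε h0 h1 => ?_
    have n1 : ‖z + ε * z‖ = (1 + ε) * ‖z‖ := by
      have : z + ε * z = ((1 + ε : ℝ) : ℂ) * z := by push_cast; ring
      rw [this, norm_mul, Complex.norm_real, Real.norm_of_nonneg (by linarith)]
    have n2 : ‖1 + (z + ε * z)‖ ≤ ‖1 + z‖ + ε * ‖z‖ := by
      rw [← add_assoc]
      refine (norm_add_le _ _).trans ?_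
      rw [norm_mul, Complex.norm_real, Real.norm_of_nonneg h0.le]
    have hz1 : 0 < ‖z‖ := by linarith [mul_nonneg hγ0 (norm_nonneg (1 + z))]
    change 1 < ‖z + ε * z‖ - γ * ‖1 + (z + ε * z)‖
    rw [n1]
    have h3 := mul_le_mul_of_nonneg_left n2 hγ0
    have h4 := mul_lt_mul_of_pos_right hγ1 (mul_pos h0 hz1)
    linarith

/-! ### Multipliers of the disk and of its exterior -/

lemma norm_add_le_of_nonneg (hγ0 : 0 ≤ γ) (s w : ℂ) : ‖s + γ * w‖ ≤ ‖s‖ + γ * ‖w‖ := by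
  refine (norm_add_le _ _).trans ?_
  rw [norm_mul, Complex.norm_real, Real.norm_of_nonneg hγ0]

lemma exists_norm_one_mul_norm_eq (w : ℂ) : ∃ e : ℂ, ‖e‖ = 1 ∧ w = e * ‖w‖ := by
  rcases eq_or_ne w 0 with rfl | hw
  · exact ⟨1, by simp, by simp⟩
  · have hw' : (‖w‖ : ℂ) ≠ 0 := by exact_mod_cast norm_ne_zero_iff.2 hw
    refine ⟨w / ‖w‖, ?_, by field_simp⟩
    rw [norm_div, Complex.norm_real, norm_norm, div_self (norm_ne_zero_iff.2 hw)]

/-- The triangle inequality `‖τ - γ α‖ ≤ ‖τ + γ α β‖ + γ ‖α (1 + β)‖` turns a bound on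
`‖β‖ + γ ‖1 + β‖` into membership of `-α β` in `Ω_{τ,γ}`. -/
lemma neg_mul_mem_circDomain (hτ : τ ≠ 0) (hγ0 : 0 ≤ γ) (hγ1 : γ < 1) {α β : ℂ}
    (h : ‖α‖ * (‖β‖ + γ * ‖1 + β‖) < ‖τ - γ * α‖) : -α * β ∈ circDomain τ γ := by
  rw [mem_circDomain hτ hγ0 hγ1]
  have h1 := norm_add_le_of_nonneg hγ0 (τ - γ * (-α * β)) (-(α * (1 + β)))
  have h2 : τ - γ * (-α * β) + γ * -(α * (1 + β)) = τ - γ * α := by ring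
  rw [h2, norm_neg, norm_mul] at h1
  rw [norm_mul, norm_neg]
  linarith

/-- Outside the inner loop the estimate fails: for `f = ‖β‖ + γ ‖1 + β‖ ≥ 1`, the image `α` of
the point `u` of modulus `1 / f` with `(1 + β) u ≤ 0` is not mapped into `Ω_{τ,γ}`. -/
lemma exists_neg_mul_notMem_circDomain (hτ : τ ≠ 0) (hγ0 : 0 ≤ γ) (hγ1 : γ < 1) {β : ℂ}
    (hβ : 1 ≤ ‖β‖ + γ * ‖1 + β‖) :
    ∃ α : ℂ, ‖α‖ * (‖β‖ + γ * ‖1 + β‖) = ‖τ - γ * α‖ ∧ 0 < ‖τ - γ * α‖ ∧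
      -α * β ∉ circDomain τ γ := by
  obtain ⟨e, he, hβe⟩ := exists_norm_one_mul_norm_eq (1 + β)
  set f := ‖β‖ + γ * ‖1 + β‖ with hf
  have hf0 : 0 < f := by linarith
  have hfC : (f : ℂ) ≠ 0 := by exact_mod_cast hf0.ne'
  have he0 : e ≠ 0 := by rintro rfl; simp at he
  -- This is `e * f` times the denominator `1 + γ u` of `w_{τ,γ}` at `u = -1 / (e * f)`.
  have hd : e * f - γ ≠ 0 := by
    intro h
    have h1 : ‖e * f‖ = ‖(γ : ℂ)‖ := by rw [sub_eq_zero.1 h]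
    rw [norm_mul, he, Complex.norm_real, Complex.norm_real, Real.norm_of_nonneg hγ0,
      Real.norm_of_nonneg hf0.le] at h1
    linarith
  have hα : τ - γ * (-τ / (e * f - γ)) = τ * (e * f) / (e * f - γ) := by field_simp; ring
  refine ⟨-τ / (e * f - γ), ?_, ?_, ?_⟩
  · rw [hα, norm_div, norm_div, norm_mul, norm_mul, he, norm_neg, Complex.norm_real,
      Real.norm_of_nonneg hf0.le]
    ring
  · rw [hα]
    exact norm_pos_iff.2 (div_ne_zero (mul_ne_zero hτ (mul_ne_zero he0 hfC)) hd)
  · rw [mem_circDomain hτ hγ0 hγ1, not_lt]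
    have h1 : τ - γ * (-(-τ / (e * f - γ)) * β) = τ * (e * ‖β‖) / (e * f - γ) := by
      have hfc : (f : ℂ) = ‖β‖ + γ * ‖1 + β‖ := by rw [hf]; push_cast; rfl
      field_simp
      rw [hfc]
      linear_combination -γ * hβe
    rw [h1]
    simp only [norm_div, norm_mul, norm_neg, he, Complex.norm_real, norm_norm, one_mul]
    exact (div_mul_eq_mul_div _ _ _).ge

/-- Division by `-a` maps `β` outside the closed disk as soon as `‖β‖` exceeds
`‖τ a - γ‖ + γ ‖1 + β‖`. -/
lemma notMem_closure_circDomain_of_lt (hτ : τ ≠ 0) (hγ0 : 0 ≤ γ) (hγ1 : γ < 1) {a ζ : ℂ}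
    (h : ‖τ * a - γ‖ + γ * ‖1 + -a * ζ‖ < ‖-a * ζ‖) : ζ ∉ closure (circDomain τ γ) := by
  rw [mem_closure_circDomain hτ hγ0 hγ1, not_le]
  have h1 := norm_add_le_of_nonneg hγ0 (τ * a - γ) (1 + -a * ζ)
  have h2 : τ * a - γ + γ * (1 + -a * ζ) = a * (τ - γ * ζ) := by ring
  rw [h2, norm_mul] at h1
  rw [norm_mul (-a) ζ, norm_neg] at h
  exact lt_of_mul_lt_mul_left (h1.trans_lt h) (norm_nonneg a)

lemma exists_div_mem_closure_circDomain (hτ : τ ≠ 0) (hγ0 : 0 ≤ γ) (hγ1 : γ < 1) {β : ℂ} {t : ℝ}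
    (ht : γ < t) (hβ : ‖β‖ ≤ t + γ * ‖1 + β‖) :
    ∃ a : ℂ, a ≠ 0 ∧ ‖τ * a - γ‖ = t ∧ -β / a ∈ closure (circDomain τ γ) := by
  obtain ⟨e, he, hβe⟩ := exists_norm_one_mul_norm_eq (1 + β)
  have hs : ‖t * e‖ = t := by
    rw [norm_mul, he, Complex.norm_real, Real.norm_of_nonneg (by linarith), mul_one]
  have ha : t * e + γ ≠ 0 := by
    intro h
    rw [eq_neg_of_add_eq_zero_left h, norm_neg, Complex.norm_real, Real.norm_of_nonneg hγ0] at hs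
    exact ht.ne hs
  refine ⟨(t * e + γ) / τ, div_ne_zero ha hτ, ?_, ?_⟩
  · rw [mul_div_cancel₀ _ hτ, add_sub_cancel_right, hs]
  · rw [mem_closure_circDomain hτ hγ0 hγ1]
    have h1 : τ - γ * (-β / ((t * e + γ) / τ)) =
        e * ((t + γ * ‖1 + β‖ : ℝ) : ℂ) / ((t * e + γ) / τ) := by
      push_cast
      field_simp
      linear_combination γ * hβe
    rw [h1, norm_div (-β), norm_div (e * _), norm_neg, norm_mul, he, one_mul, Complex.norm_real]
    exact div_le_div_of_nonneg_right (hβ.trans (le_abs_self _)) (norm_nonneg _)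

end Geometry

/-! ### Polynomials as convolution operators -/

lemma X_sub_C_pow_mem_polysDegEq {K : Set ℂ} (n : ℕ) {α : ℂ} (hα : α ∈ K) :
    (X - C α) ^ n ∈ polysDegEq n K := by
  refine ⟨by rw [degree_pow, degree_X_sub_C, nsmul_one], fun z hz => ?_⟩
  rw [eval_pow, eval_sub, eval_X, eval_C] at hz
  rwa [sub_eq_zero.1 (eq_zero_of_pow_eq_zero hz)]

lemma one_sub_C_mul_X_pow_mem_polysDegLE {U : Set ℂ} (n : ℕ) {a : ℂ}
    (ha : a⁻¹ ∈ U) : (1 - C a * X) ^ n ∈ polysDegLE n U := by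
  refine ⟨?_, fun z hz => ?_⟩
  · rw [← reflect_X_sub_C_pow]
    exact degree_le_of_natDegree_le (natDegree_reflect_le.trans (by simp [natDegree_pow]))
  · simp only [eval_pow, eval_sub, eval_one, eval_mul, eval_C, eval_X] at hz
    have h1 : a * z = 1 := (sub_eq_zero.1 (eq_zero_of_pow_eq_zero hz)).symm
    rwa [eq_inv_of_mul_eq_one_right h1]

lemma gsConv_one_add_X_pow {n : ℕ} {Q : ℂ[X]} (hQ : Q.degree ≤ n) :
    gsConv n ((1 + X) ^ n) Q = Q := by
  ext k
  rw [coeff_gsConv, coeff_one_add_X_pow]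
  split_ifs with hk
  · rw [mul_div_cancel_left₀ _ (choose_cast_ne_zero hk)]
  · exact (coeff_eq_zero_of_degree_lt (hQ.trans_lt (by exact_mod_cast not_le.1 hk))).symm

lemma one_add_X_pow_eq (n : ℕ) : (1 + X : ℂ[X]) ^ n = (X - C (-1)) ^ n := by
  rw [C_neg, C_1, sub_neg_eq_add, add_comm]

section

variable {τ : ℂ} {γ : ℝ} {n : ℕ} {Q : ℂ[X]}

/-- Sufficiency for the disk: with `K` the disk or its closure and `S` the inner loop or its
closure, `hKS` says that `-α β` lies in `Ω_{τ,γ}` for `α ∈ K` and `β ∈ S`. -/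
lemma gsConv_mem_polysDegEq_circDomain (hτ : τ ≠ 0) (hγ0 : 0 ≤ γ) (hγ1 : γ < 1) {K S : Set ℂ}
    (hK : IsDisk K)
    (hKS : ∀ α ∈ K, ∀ β ∈ S, ‖α‖ * (‖β‖ + γ * ‖1 + β‖) < ‖τ - γ * α‖) (hQ : Q ∈ polysDegEq n S)
    {P : ℂ[X]} (hP : P ∈ polysDegEq n K) : gsConv n P Q ∈ polysDegEq n (circDomain τ γ) := by
  refine ⟨?_, fun ζ hζ => ?_⟩
  · rw [degree_eq_iff_coeff_ne_zero (degree_gsConv_le n P Q), coeff_gsConv_self]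
    exact mul_ne_zero (coeff_ne_zero_of_eq_degree hP.1) (coeff_ne_zero_of_eq_degree hQ.1)
  · rcases eval_gsConv_eq_zero_of_disk hK hP hQ.1 hζ with rfl | ⟨α, hα, β, hβ, rfl⟩
    · simpa [mem_circDomain hτ hγ0 hγ1] using hτ
    · exact neg_mul_mem_circDomain hτ hγ0 hγ1 (hKS α hα β (hQ.2 β hβ))

/-- Necessity for the disk, by testing on `(X - α) ^ n`: the hypothesis `hKS` says that for `β`
outside `S` the extremal `α` of `exists_neg_mul_notMem_circDomain` lies in `K`. -/
lemma mem_polysDegEq_of_gsConv (hτ : τ ≠ 0) (hγ0 : 0 ≤ γ) (hγ1 : γ < 1) (hQ : Q.degree ≤ n)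
    {K S : Set ℂ} (hK : K.Nonempty)
    (hKS : ∀ β ∉ S, 1 ≤ ‖β‖ + γ * ‖1 + β‖ ∧
      ∀ α, ‖α‖ * (‖β‖ + γ * ‖1 + β‖) = ‖τ - γ * α‖ → 0 < ‖τ - γ * α‖ → α ∈ K)
    (h : ∀ P ∈ polysDegEq n K, gsConv n P Q ∈ polysDegEq n (circDomain τ γ)) :
    Q ∈ polysDegEq n S := by
  refine ⟨?_, fun β hβ => ?_⟩
  · obtain ⟨α, hα⟩ := hK
    have h1 := coeff_ne_zero_of_eq_degree (h _ (X_sub_C_pow_mem_polysDegEq n hα)).1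
    rw [coeff_gsConv_self] at h1
    exact (degree_eq_iff_coeff_ne_zero hQ).2 (right_ne_zero_of_mul h1)
  · by_contra hS
    obtain ⟨hβ1, hα⟩ := hKS β hS
    obtain ⟨α, h1, h2, h3⟩ := exists_neg_mul_notMem_circDomain hτ hγ0 hγ1 hβ1
    refine h3 ((h _ (X_sub_C_pow_mem_polysDegEq n (hα α h1 h2))).2 _ ?_)
    rw [eval_gsConv_X_sub_C_pow_neg_mul hQ, hβ, mul_zero]

theorem multiplier_closure_circDomain_iff (hτ : τ ≠ 0) (hγ0 : 0 ≤ γ) (hγ1 : γ < 1)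
    (hQ : Q.degree ≤ n) :
    (∀ P ∈ polysDegEq n (closure (circDomain τ γ)),
        gsConv n P Q ∈ polysDegEq n (circDomain τ γ)) ↔ Q ∈ polysDegEq n (limaconInner γ) := by
  constructor
  · refine mem_polysDegEq_of_gsConv hτ hγ0 hγ1 hQ
      ⟨0, by simp [mem_closure_circDomain hτ hγ0 hγ1]⟩ fun β hβ => ?_
    have hβ' : 1 ≤ ‖β‖ + γ * ‖1 + β‖ := not_lt.1 hβ
    refine ⟨hβ', fun α h1 _ => ?_⟩
    rw [mem_closure_circDomain hτ hγ0 hγ1, ← h1]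
    exact le_mul_of_one_le_right (norm_nonneg α) hβ'
  · refine fun h P hP => gsConv_mem_polysDegEq_circDomain hτ hγ0 hγ1
      (isDisk_closure_circDomain hτ hγ0 hγ1) (fun α hα β hβ => ?_) h hP
    rw [mem_closure_circDomain hτ hγ0 hγ1] at hα
    have hβ' : ‖β‖ + γ * ‖1 + β‖ < 1 := hβ
    rcases eq_or_ne α 0 with rfl | hα0
    · simpa using hτ
    · exact (mul_lt_of_lt_one_right (norm_pos_iff.2 hα0) hβ').trans_le hα

theorem multiplier_circDomain_iff (hτ : τ ≠ 0) (hγ0 : 0 ≤ γ) (hγ1 : γ < 1)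
    (hQ : Q.degree ≤ n) :
    (∀ P ∈ polysDegEq n (circDomain τ γ),
        gsConv n P Q ∈ polysDegEq n (circDomain τ γ)) ↔
      Q ∈ polysDegEq n (closure (limaconInner γ)) := by
  rw [closure_limaconInner hγ0 hγ1]
  constructor
  · refine mem_polysDegEq_of_gsConv hτ hγ0 hγ1 hQ
      ⟨0, by simpa [mem_circDomain hτ hγ0 hγ1] using hτ⟩ fun β hβ => ?_
    have hβ' : 1 < ‖β‖ + γ * ‖1 + β‖ := not_le.1 hβ
    refine ⟨hβ'.le, fun α h1 h2 => ?_⟩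
    rw [mem_circDomain hτ hγ0 hγ1]
    rw [← h1] at h2 ⊢
    exact lt_mul_of_one_lt_right (pos_of_mul_pos_left h2 (by linarith)) hβ'
  · refine fun h P hP => gsConv_mem_polysDegEq_circDomain hτ hγ0 hγ1
      (isDisk_circDomain hτ hγ0 hγ1) (fun α hα β hβ => ?_) h hP
    rw [mem_circDomain hτ hγ0 hγ1] at hα
    exact (mul_le_of_le_one_right (norm_nonneg α) hβ).trans_lt hα

lemma zero_notMem_compl_circDomain (hτ : τ ≠ 0) (hγ0 : 0 ≤ γ) (hγ1 : γ < 1) :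
    (0 : ℂ) ∉ (circDomain τ γ)ᶜ := by
  simpa [mem_circDomain hτ hγ0 hγ1] using hτ

theorem multiplier_compl_circDomain_iff (hτ : τ ≠ 0) (hγ0 : 0 ≤ γ) (hγ1 : γ < 1)
    (hQ : Q.degree ≤ n) :
    (∀ P ∈ polysDegLE n (circDomain τ γ)ᶜ,
        gsConv n P Q ∈ polysDegLE n (closure (circDomain τ γ))ᶜ) ↔
      Q ∈ polysDegLE n (limaconOuter γ) := by
  have h0 := zero_notMem_compl_circDomain hτ hγ0 hγ1
  constructor
  · refine fun h => ⟨hQ, fun β hβ => ?_⟩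
    by_contra hS
    have hβ' : ‖β‖ - γ * ‖1 + β‖ ≤ 1 := not_lt.1 hS
    obtain ⟨a, ha0, ha, hζ⟩ := exists_div_mem_closure_circDomain hτ hγ0 hγ1 (β := β) hγ1
      (by linarith)
    refine (h _ (one_sub_C_mul_X_pow_mem_polysDegLE n (a := a) ?_)).2 (-β / a) ?_ hζ
    · rw [Set.mem_compl_iff, mem_circDomain hτ hγ0 hγ1, not_lt]
      rw [← inv_inv a, norm_mul_inv_sub (inv_ne_zero ha0),
        div_eq_one_iff_eq (norm_ne_zero_iff.2 (inv_ne_zero ha0))] at ha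
      exact ha.le
    · rw [eval_gsConv_one_sub_C_mul_X_pow hQ, neg_mul, mul_div_cancel₀ _ ha0, neg_neg, hβ]
  · refine fun h P hP => ⟨degree_gsConv_le n P Q, fun ζ hζ => ?_⟩
    have hinv : ∀ z ∈ (circDomain τ γ)ᶜ, z⁻¹ ∈ {a : ℂ | ‖τ * a - γ‖ ≤ 1} := by
      intro z hz
      have hz0 : z ≠ 0 := fun h' => h0 (h' ▸ hz)
      rw [Set.mem_compl_iff, mem_circDomain hτ hγ0 hγ1, not_lt] at hz
      rw [Set.mem_ofPred_eq, norm_mul_inv_sub hz0]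
      exact div_le_one_of_le₀ hz (norm_nonneg z)
    obtain ⟨a, ha, hβ⟩ := eval_gsConv_eq_zero_of_inv_disk
      (isDisk_inv_compl_circDomain (γ := γ) hτ)
      (by simpa [abs_of_nonneg hγ0] using hγ1.le) h0 hinv hP hQ hζ
    have h1 : 1 < ‖-a * ζ‖ - γ * ‖1 + -a * ζ‖ := h.2 _ hβ
    have h2 : ‖τ * a - γ‖ ≤ 1 := ha
    exact notMem_closure_circDomain_of_lt hτ hγ0 hγ1 (by linarith)

theorem multiplier_compl_closure_circDomain_iff (hτ : τ ≠ 0) (hγ0 : 0 ≤ γ) (hγ1 : γ < 1)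
    (hQ : Q.degree ≤ n) :
    (∀ P ∈ polysDegLE n (closure (circDomain τ γ))ᶜ,
        gsConv n P Q ∈ polysDegLE n (closure (circDomain τ γ))ᶜ) ↔
      Q ∈ polysDegLE n (closure (limaconOuter γ)) := by
  rw [closure_limaconOuter hγ0 hγ1]
  have h0 : (0 : ℂ) ∉ (closure (circDomain τ γ))ᶜ := fun h =>
    zero_notMem_compl_circDomain hτ hγ0 hγ1 fun h' => h (subset_closure h')
  constructor
  · refine fun h => ⟨hQ, fun β hβ => ?_⟩
    by_contra hS
    have hβ' : ‖β‖ - γ * ‖1 + β‖ < 1 := not_le.1 hS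
    -- Taking `t` above `γ` keeps the zero of the test polynomial away from infinity.
    obtain ⟨t, ht, ht1⟩ := exists_between (max_lt hγ1 hβ')
    rw [max_lt_iff] at ht
    obtain ⟨a, ha0, ha, hζ⟩ := exists_div_mem_closure_circDomain hτ hγ0 hγ1 (β := β) ht.1
      (by linarith)
    refine (h _ (one_sub_C_mul_X_pow_mem_polysDegLE n (a := a) ?_)).2 (-β / a) ?_ hζ
    · rw [Set.mem_compl_iff, mem_closure_circDomain hτ hγ0 hγ1, not_le]
      rw [← ha, ← inv_inv a, norm_mul_inv_sub (inv_ne_zero ha0),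
        div_lt_one (norm_pos_iff.2 (inv_ne_zero ha0))] at ht1
      exact ht1
    · rw [eval_gsConv_one_sub_C_mul_X_pow hQ, neg_mul, mul_div_cancel₀ _ ha0, neg_neg, hβ]
  · refine fun h P hP => ⟨degree_gsConv_le n P Q, fun ζ hζ => ?_⟩
    have hinv : ∀ z ∈ (closure (circDomain τ γ))ᶜ, z⁻¹ ∈ {a : ℂ | ‖τ * a - γ‖ < 1} := by
      intro z hz
      have hz0 : z ≠ 0 := fun h' => h0 (h' ▸ hz)
      rw [Set.mem_compl_iff, mem_closure_circDomain hτ hγ0 hγ1, not_le] at hz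
      rw [Set.mem_ofPred_eq, norm_mul_inv_sub hz0]
      exact (div_lt_one (norm_pos_iff.2 hz0)).2 hz
    obtain ⟨a, ha, hβ⟩ := eval_gsConv_eq_zero_of_inv_disk
      (isDisk_inv_compl_closure_circDomain (γ := γ) hτ)
      (by simpa [abs_of_nonneg hγ0] using hγ1) h0 hinv hP hQ hζ
    have h1 : 1 ≤ ‖-a * ζ‖ - γ * ‖1 + -a * ζ‖ := h.2 _ hβ
    have h2 : ‖τ * a - γ‖ < 1 := ha
    exact notMem_closure_circDomain_of_lt hτ hγ0 hγ1 (by linarith)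

end

theorem mainTheorem2 (n : ℕ) (τ : ℂ) (hτ : τ ≠ 0) (γ : ℝ) (hγ0 : 0 ≤ γ) (hγ1 : γ < 1)
    (Q : Polynomial ℂ) (hQ : Q.degree ≤ (n : WithBot ℕ)) :
    ((∀ P ∈ polysDegEq n (closure (circDomain τ γ)),
        gsConv n P Q ∈ polysDegEq n (circDomain τ γ)) ↔
      Q ∈ polysDegEq n (limaconInner γ)) ∧
    ((∀ P ∈ polysDegEq n (circDomain τ γ),
        gsConv n P Q ∈ polysDegEq n (circDomain τ γ)) ↔
      Q ∈ polysDegEq n (closure (limaconInner γ))) ∧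
    ((∀ P ∈ polysDegLE n (circDomain τ γ)ᶜ,
        gsConv n P Q ∈ polysDegLE n (closure (circDomain τ γ))ᶜ) ↔
      Q ∈ polysDegLE n (limaconOuter γ)) ∧
    ((∀ P ∈ polysDegLE n (closure (circDomain τ γ))ᶜ,
        gsConv n P Q ∈ polysDegLE n (closure (circDomain τ γ))ᶜ) ↔
      Q ∈ polysDegLE n (closure (limaconOuter γ))) ∧
    ((∀ P ∈ polysDegEq n (closure (limaconInner γ)),
        gsConv n P Q ∈ polysDegEq n (limaconInner γ)) ↔
      Q ∈ polysDegEq n (limaconInner γ)) ∧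
    ((∀ P ∈ polysDegLE n (closure (limaconOuter γ)),
        gsConv n P Q ∈ polysDegLE n (limaconOuter γ)) ↔
      Q ∈ polysDegLE n (limaconOuter γ)) := by
  refine ⟨multiplier_closure_circDomain_iff hτ hγ0 hγ1 hQ,
    multiplier_circDomain_iff hτ hγ0 hγ1 hQ, multiplier_compl_circDomain_iff hτ hγ0 hγ1 hQ,
    multiplier_compl_closure_circDomain_iff hτ hγ0 hγ1 hQ, ⟨fun h => ?_, fun h P hP => ?_⟩,
    ⟨fun h => ?_, fun h P hP => ?_⟩⟩
  · -- The unit `(1 + z) ^ n` of the convolution is an admissible `P`: its zero `-1` lies on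
    -- the limaçon.
    have h1 := h _ (X_sub_C_pow_mem_polysDegEq n (α := -1)
      (by rw [closure_limaconInner hγ0 hγ1]; simp))
    rwa [← one_add_X_pow_eq, gsConv_one_add_X_pow hQ] at h1
  · rw [← multiplier_closure_circDomain_iff hτ hγ0 hγ1 (degree_gsConv_le n P Q)]
    rw [← multiplier_circDomain_iff hτ hγ0 hγ1 hP.1.le] at hP
    rw [← multiplier_closure_circDomain_iff hτ hγ0 hγ1 hQ] at h
    intro R hR
    rw [gsConv_comm n P Q, ← gsConv_assoc]
    exact hP _ (h R hR)
  · have h1 := X_sub_C_pow_mem_polysDegEq n (α := -1) (K := closure (limaconOuter γ))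
      (by rw [closure_limaconOuter hγ0 hγ1]; simp)
    have h2 := h _ ⟨h1.1.le, h1.2⟩
    rwa [← one_add_X_pow_eq, gsConv_one_add_X_pow hQ] at h2
  · rw [← multiplier_compl_circDomain_iff hτ hγ0 hγ1 (degree_gsConv_le n P Q)]
    rw [← multiplier_compl_closure_circDomain_iff hτ hγ0 hγ1 hP.1] at hP
    rw [← multiplier_compl_circDomain_iff hτ hγ0 hγ1 hQ] at h
    intro R hR
    rw [gsConv_comm n P Q, ← gsConv_assoc]
    exact hP _ (h R hR)
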